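/- **Theorem 3.6 (Quantum Max-flow Min-cut Theorem).** Let $G=(\tilde V,E)$ be a finite undirected graph, loops and parallel edges being allowed, and let $\tilde V = S\sqcup T\sqcup V$ where every element of $S\sqcup T$ has degree $1$; the elements of $S$ are the inputs, those of $T$ the outputs, and those of $V$ are called vertices. For $u\in S\sqcup T$ let $e(u)$ be the edge at $u$, and for $v\in V$ of degree $d_v$ let $e(v,1),\dots,e(v,d_v)$ be the edges whose ends are incident to $v$, listed in a fixed local ordering of these ends (a loop at $v$ is listed twice). Let $c:E\to\mathbb N$, $e\mapsto c_e$, be a capacity function. A tensor assignment $\mathcal T$ chooses, independently for every $v\in V$, a tensor $\mathcal T_v\in\bigotimes_{i=1}^{d_v}\mathbb C^{c_{e(v,i)}}$. Put $V_S=\bigotimes_{u\in S}\mathbb C^{c_{e(u)}}$ and $V_T=\bigotimes_{u\in T}\mathbb C^{c_{e(u)}}$, and let $\beta(G,c;\mathcal T)\in\mathrm{Hom}(V_S,V_T)$ be the linear map with matrix entries, in the standard bases, $$\langle I_T|\beta(G,c;\mathcal T)|I_S\rangle=\sum_{W}\ \prod_{v\in V}(\mathcal T_v)_{W_{e(v,1)},\dots,W_{e(v,d_v)}},$$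 where $W$ runs over all $(W_e)_{e\in E}$ with $W_e\in\{1,\dots,c_e\}$ that agree with the multi-index $I_S$ on the input edges $e(u)$, $u\in S$, and with the multi-index $I_T$ on the output edges $e(u)$, $u\in T$. The quantum max-flow $\mathrm{QMF}(G,c)$ is the maximum of $\operatorname{rank}\beta(G,c;\mathcal T)$ over all tensor assignments $\mathcal T$. An edge cut set is a set $C\subseteq E$ for which there is a partition $\tilde V=\bar S\sqcup\bar T$ with $S\subseteq\bar S$ and $T\subseteq\bar T$ such that $C$ is the set of all edges with one end in $\bar S$ and the other in $\bar T$. The quantum min-cut $\mathrm{QMC}(G,c)$ is the minimum of $\prod_{e\in C}c_e$ over all edge cut sets $C$. If there is an integer $d>0$ such that every capacity $c_e$ is of the form $d^{k}$ with $k\in\mathbb Z_{\ge 0}$ (the exponent may depend on $e$), then $$\mathrm{QMF}(G,c)=\mathrm{QMC}(G,c).$$ -/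

import Mathlib

/-- A finite undirected graph with inputs `S` and outputs `T`, together with a local ordering.

`V` is the type of (internal) vertices, `S` and `T` are the types of input and output open ends, and
`E` is the type of edges, so that the full vertex set is `V ⊕ (S ⊕ T)`. Loops and parallel edges
are allowed. Each edge `e` has the two ends `(e, false)` and `(e, true)`; the two labels only tell
the ends apart and carry no orientation. -/
structure OpenGraph (V S T E : Type*) where
  /-- The vertex or open end at which a given end of an edge sits. -/
  attach : E × Bool → V ⊕ (S ⊕ T)
  /-- The edge end that sits at a given open end. -/
  openEnd : S ⊕ T → E × Bool
  /-- Inputs and outputs have degree one: exactly one edge end sits there. -/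
  attach_eq_inr_iff : ∀ (h : E × Bool) (u : S ⊕ T), attach h = Sum.inr u ↔ h = openEnd u
  /-- The degree of a vertex; a loop counts twice. -/
  deg : V → ℕ
  /-- The local ordering of the edge ends incident to a vertex. -/
  localOrder : ∀ v : V, Fin (deg v) ≃ {h : E × Bool // attach h = Sum.inl v}

namespace OpenGraph

variable {V S T E : Type*}

/-- The edge `e(v, i)`: the `i`-th edge at the vertex `v` in the local ordering. -/
def edgeAt (G : OpenGraph V S T E) (v : V) (i : Fin (G.deg v)) : E :=
  (G.localOrder v i).1.1

/-- The input edge `e(u)` of an input `u`. -/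
def inputEdge (G : OpenGraph V S T E) (u : S) : E := (G.openEnd (Sum.inl u)).1

/-- The output edge `e(u)` of an output `u`. -/
def outputEdge (G : OpenGraph V S T E) (u : T) : E := (G.openEnd (Sum.inr u)).1

/-- Multi-indices for the input edges: the standard basis of `V_S = ⨂_{u ∈ S} ℂ^{c (e u)}`. -/
abbrev InputIndex (G : OpenGraph V S T E) (c : E → ℕ) : Type _ :=
  ∀ u : S, Fin (c (G.inputEdge u))

/-- Multi-indices for the output edges: the standard basis of `V_T = ⨂_{u ∈ T} ℂ^{c (e u)}`. -/
abbrev OutputIndex (G : OpenGraph V S T E) (c : E → ℕ) : Type _ :=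
  ∀ u : T, Fin (c (G.outputEdge u))

/-- A tensor assignment: every vertex `v` independently gets a tensor in
`ℂ^{c (e(v,1))} ⊗ ⋯ ⊗ ℂ^{c (e(v,d_v))}`, given by its components in the standard basis. -/
abbrev TensorAssignment (G : OpenGraph V S T E) (c : E → ℕ) : Type _ :=
  ∀ v : V, (∀ i : Fin (G.deg v), Fin (c (G.edgeAt v i))) → ℂ

/-- The multi-index `W` for all edges extends the input index `I` and the output index `J`. -/
abbrev Extends (G : OpenGraph V S T E) (c : E → ℕ) (W : ∀ e : E, Fin (c e))
    (I : G.InputIndex c) (J : G.OutputIndex c) : Prop :=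
  (∀ u : S, W (G.inputEdge u) = I u) ∧ (∀ u : T, W (G.outputEdge u) = J u)

/-- The linear map `β(G, c; 𝒯) : V_S → V_T` obtained by contracting the tensor network, as a
matrix in the standard bases:
`⟨J| β |I⟩ = ∑_{W extending I, J} ∏_v ⟨W|_v | 𝒯_v⟩`. -/
def contraction [Fintype V] [Fintype S] [Fintype T] [Fintype E] [DecidableEq E]
    (G : OpenGraph V S T E) (c : E → ℕ) (τ : G.TensorAssignment c) :
    Matrix (G.OutputIndex c) (G.InputIndex c) ℂ :=
  fun J I => ∑ W : (∀ e : E, Fin (c e)) with G.Extends c W I J,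
    ∏ v : V, τ v (fun i => W (G.edgeAt v i))

/-- `C` is an edge cut set: there is a partition of all vertices and open ends into a part `A`
containing all inputs and its complement containing all outputs, such that `C` is the set of the
edges with one end in `A` and the other end outside `A`. -/
def IsEdgeCut (G : OpenGraph V S T E) (C : Finset E) : Prop :=
  ∃ A : Set (V ⊕ (S ⊕ T)),
    (∀ u : S, Sum.inr (Sum.inl u) ∈ A) ∧ (∀ u : T, Sum.inr (Sum.inr u) ∉ A) ∧
    ∀ e : E, e ∈ C ↔ ∃ b : Bool, G.attach (e, b) ∈ A ∧ G.attach (e, !b) ∉ A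

/-- The quantum max-flow: the maximal rank of the contraction over all tensor assignments. -/
noncomputable def quantumMaxFlow [Fintype V] [Fintype S] [Fintype T] [Fintype E]
    [DecidableEq S] [DecidableEq E] (G : OpenGraph V S T E) (c : E → ℕ) : ℕ :=
  sSup {r : ℕ | ∃ τ : G.TensorAssignment c, r = (G.contraction c τ).rank}

/-- The quantum min-cut: the minimum over all edge cut sets of the product of the capacities. -/
noncomputable def quantumMinCut (G : OpenGraph V S T E) (c : E → ℕ) : ℕ :=
  sInf {q : ℕ | ∃ C : Finset E, G.IsEdgeCut C ∧ q = ∏ e ∈ C, c e}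

/-- The supremum in the quantum max-flow is a maximum. -/
theorem quantumMaxFlow_isGreatest [Fintype V] [Fintype S] [Fintype T] [Fintype E]
    [DecidableEq S] [DecidableEq E] (G : OpenGraph V S T E) (c : E → ℕ) :
    IsGreatest {r : ℕ | ∃ τ : G.TensorAssignment c, r = (G.contraction c τ).rank}
      (G.quantumMaxFlow c) := by
  have hb : BddAbove {r : ℕ | ∃ τ : G.TensorAssignment c, r = (G.contraction c τ).rank} := by
    refine ⟨Fintype.card (G.InputIndex c), ?_⟩
    rintro r ⟨τ, rfl⟩
    exact Matrix.rank_le_card_width _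
  exact ⟨Nat.sSup_mem ⟨_, fun _ _ => 0, rfl⟩ hb, fun r hr => le_csSup hb hr⟩

/-- The infimum in the quantum min-cut is a minimum. -/
theorem quantumMinCut_isLeast [Fintype E] (G : OpenGraph V S T E) (c : E → ℕ) :
    IsLeast {q : ℕ | ∃ C : Finset E, G.IsEdgeCut C ∧ q = ∏ e ∈ C, c e}
      (G.quantumMinCut c) := by
  classical
  refine ⟨Nat.sInf_mem ?_, fun q hq => Nat.sInf_le hq⟩
  let A : Set (V ⊕ (S ⊕ T)) := {x | ∃ u : S, x = Sum.inr (Sum.inl u)}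
  refine ⟨_, Finset.univ.filter
    (fun e => ∃ b : Bool, G.attach (e, b) ∈ A ∧ G.attach (e, !b) ∉ A), ⟨A, ?_, ?_, ?_⟩, rfl⟩
  · intro u
    exact ⟨u, rfl⟩
  · rintro u ⟨w, hw⟩
    simp at hw
  · intro e
    simp

end OpenGraph

/-! Upper bound: splitting the sum over the edge indices along a cut `C` writes the contraction as a
matrix product through the index set of `C`, so its rank is at most the product of the capacities
over `C`. Lower bound: an index in `Fin (d ^ k)` is a string of `k` base-`d` digits, so an edge acts
as `k` parallel edges of capacity `d`. If `n` is the least exponent sum of a cut, Menger's theorem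
(here deduced from Hall's theorem) links inputs to outputs by `n` disjoint sets of copies. Tensors
that force digits to agree along each set transmit `n` free digits, which gives a nonsingular
diagonal submatrix of size `d ^ n`. -/

/-! ### Menger's theorem from Hall's theorem -/

/-- A form of Menger's theorem: if every set `Z` disjoint from `B` has, together with its
neighbours and with `A`, at least `#Z + n` elements, then there are `n` pairwise disjoint sets, each
of which contains a walk from `A` to `B`. -/
theorem exists_disjoint_linking {X : Type*} [Fintype X] (r : X → X → Prop)
    (A B : Set X) (n : ℕ)
    (h : ∀ Z : Set X, Disjoint Z B →
      n + Z.ncard ≤ {y | y ∈ A ∨ ∃ z ∈ Z, z = y ∨ r z y}.ncard) :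
    ∃ P : Fin n → X → Prop, (∀ i j x, P i x → P j x → i = j) ∧
      ∀ i, ∃ a ∈ A, ∃ b ∈ B, P i a ∧
        Relation.ReflTransGen (fun x y => (x = y ∨ r x y) ∧ P i x ∧ P i y) a b := by
  classical
  -- A Hall matching on points and `n` tokens: a token enters at `A`, a point stays idle or moves
  -- along `r`, and a point of `B` may exit to a token. The walks are the orbits of the tokens under
  -- the matching.
  let adj : X ⊕ Fin n → X ⊕ Fin n → Prop := fun p q =>
    match p, q with
    | .inl x, .inl y => x = y ∨ r x y
    | .inl x, .inr _ => x ∈ B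
    | .inr _, .inl y => y ∈ A
    | .inr _, .inr _ => False
  obtain ⟨σ, hσ, hadj⟩ := (Finset.all_card_le_biUnion_card_iff_exists_injective
    (fun p => Finset.univ.filter (adj p))).1 (by
      intro s
      rw [← Finset.card_toLeft_add_card_toRight]
      -- A point of `B` in `s` reaches every token, and idling covers the points of `s`; the cut
      -- hypothesis is needed only when `s` avoids `B` and contains a token.
      by_cases hB : ∃ x ∈ s.toLeft, x ∈ B
      · obtain ⟨x, hx, hxB⟩ := hB
        calc _ ≤ s.toLeft.card + (Finset.univ : Finset (Fin n)).card := by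
              gcongr; exact Finset.subset_univ _
          _ = (s.toLeft.disjSum Finset.univ).card := (Finset.card_disjSum _ _).symm
          _ ≤ _ := by
            refine Finset.card_le_card ?_
            rintro (y | y) hy
            · simp only [Finset.mem_biUnion, Finset.mem_filter_univ]
              exact ⟨.inl y, by simpa using hy, Or.inl rfl⟩
            · simp only [Finset.mem_biUnion, Finset.mem_filter_univ]
              exact ⟨.inl x, by simpa using hx, hxB⟩
      · rcases s.toRight.eq_empty_or_nonempty with hQ | ⟨q, hq⟩
        · rw [hQ, Finset.card_empty, add_zero,
            ← Finset.card_map (Function.Embedding.inl (β := Fin n))]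
          refine Finset.card_le_card ?_
          intro y hy
          obtain ⟨y, hy, rfl⟩ := Finset.mem_map.1 hy
          simp only [Finset.mem_biUnion, Finset.mem_filter_univ]
          exact ⟨.inl y, by simpa using hy, Or.inl rfl⟩
        · have key := h (s.toLeft : Set X)
            (Set.disjoint_left.2 fun x hx hxB => hB ⟨x, hx, hxB⟩)
          rw [Set.ncard_coe_finset, Set.ncard_eq_toFinset_card'] at key
          calc _ ≤ s.toLeft.card + n := by
                simpa using Finset.card_le_univ s.toRight
            _ ≤ _ := (add_comm _ _).trans_le key
            _ = _ := (Finset.card_map (Function.Embedding.inl (β := Fin n))).symm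
            _ ≤ _ := by
              refine Finset.card_le_card ?_
              intro y hy
              obtain ⟨y, hy', rfl⟩ := Finset.mem_map.1 hy
              simp only [Finset.mem_biUnion, Finset.mem_filter_univ]
              rcases Set.mem_toFinset.1 hy' with hy | ⟨z, hz, hzy⟩
              · exact ⟨.inr q, by simpa using hq, hy⟩
              · exact ⟨.inl z, by simpa using hz, hzy⟩)
  simp only [Finset.mem_filter_univ] at hadj
  have start : ∀ i, ∃ a ∈ A, σ (.inr i) = .inl a := by
    intro i
    have := hadj (.inr i)
    rcases hs : σ (.inr i) with a | j
    · rw [hs] at this; exact ⟨a, this, rfl⟩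
    · rw [hs] at this; exact this.elim
  choose a haA ha using start
  let next : X → X → Prop := fun x y => σ (.inl x) = .inl y
  have hnext : ∀ x y, next x y → x = y ∨ r x y := by
    intro x y hxy
    have := hadj (.inl x)
    rwa [show σ (.inl x) = .inl y from hxy] at this
  let P : Fin n → X → Prop := fun i => Relation.ReflTransGen next (a i)
  refine ⟨P, ?_, ?_⟩
  -- Injectivity of `σ` traces a common point back to a common start; no start has a
  -- `next`-predecessor, as its preimage is a token.
  · intro i j x hi
    induction hi with
    | refl =>
      intro hj
      rcases Relation.ReflTransGen.cases_tail hj with hj | ⟨c, -, hj⟩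
      · exact Sum.inr_injective (hσ (by rw [ha, ha, hj]))
      · exact absurd (hσ ((show σ (.inl c) = _ from hj).trans (ha i).symm)) Sum.inl_ne_inr
    | tail _ hy ih =>
      intro hj
      rcases Relation.ReflTransGen.cases_tail hj with hj | ⟨c, hc, hj⟩
      · subst hj
        exact absurd (hσ ((show σ (.inl _) = _ from hy).trans (ha j).symm)) Sum.inl_ne_inr
      · have := Sum.inl_injective (hσ ((show σ (.inl _) = _ from hy).trans
          (show σ (.inl c) = _ from hj).symm))
        subst this
        exact ih hc
  · intro i
    -- An orbit missing `B` would be mapped injectively, hence by finiteness surjectively, to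
    -- itself, yet its start is hit only by a token.
    have hend : ∃ b, P i b ∧ b ∈ B := by
      by_contra! hno
      have hmap : ∀ x : {x // P i x}, ∃ y : {x // P i x}, next x y := by
        rintro ⟨x, hx⟩
        have := hadj (.inl x)
        rcases hs : σ (.inl x) with y | j
        · exact ⟨⟨y, hx.tail hs⟩, hs⟩
        · rw [hs] at this; exact absurd this (hno x hx)
      choose f hf using hmap
      have hinj : Function.Injective f := by
        intro x y hxy
        have h1 : σ (.inl x.1) = .inl (f x).1 := hf x
        have h2 : σ (.inl y.1) = .inl (f y).1 := hf y
        rw [hxy, ← h2] at h1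
        exact Subtype.ext (Sum.inl_injective (hσ h1))
      obtain ⟨x, hx⟩ := Finite.surjective_of_injective hinj ⟨a i, .refl⟩
      have h1 : σ (.inl x.1) = .inl (f x).1 := hf x
      rw [hx] at h1
      exact absurd (hσ (h1.trans (ha i).symm)) Sum.inl_ne_inr
    obtain ⟨b, hb, hbB⟩ := hend
    refine ⟨a i, haA i, b, hbB, .refl, ?_⟩
    clear hbB
    induction hb with
    | refl => exact .refl
    | tail hx hxy ih => exact ih.tail ⟨hnext _ _ hxy, hx, hx.tail hxy⟩


/-! ### Upper bound: factoring through a cut -/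

/-- A sum over dependent functions whose summand splits into a factor depending only on the
coordinates in `C` and in `L` and a factor depending only on those in `C` and outside `L` is a
matrix product through the coordinates in `C`. -/
theorem sum_pi_mul_eq_sum_pi_subtype {E : Type*} [Fintype E] [DecidableEq E] {Y : E → Type*}
    [∀ e, Fintype (Y e)] {R : Type*} [CommSemiring R] (C L : E → Prop) [DecidablePred C]
    [DecidablePred L] (w : ∀ e, Y e) :
    -- The gluing maps are chosen before `f` and `g`, so that one choice serves all matrix entries.
    -- They fill irrelevant coordinates with `w`.
    ∃ (glueL : (∀ e : {e // C e}, Y e) → (∀ e : {e // ¬ C e ∧ L e}, Y e) → ∀ e, Y e)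
      (glueR : (∀ e : {e // C e}, Y e) → (∀ e : {e // ¬ C e ∧ ¬ L e}, Y e) → ∀ e, Y e),
      ∀ f g : (∀ e, Y e) → R,
        (∀ W W' : ∀ e, Y e, (∀ e, C e ∨ L e → W e = W' e) → f W = f W') →
        (∀ W W' : ∀ e, Y e, (∀ e, C e ∨ ¬ L e → W e = W' e) → g W = g W') →
        ∑ W, f W * g W = ∑ K, (∑ W, g (glueR K W)) * ∑ W, f (glueL K W) := by
  let glueL : (∀ e : {e // C e}, Y e) → (∀ e : {e // ¬ C e ∧ L e}, Y e) → ∀ e, Y e :=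
    fun K U e => if h : C e then K ⟨e, h⟩ else if h' : L e then U ⟨e, h, h'⟩ else w e
  let glueR : (∀ e : {e // C e}, Y e) → (∀ e : {e // ¬ C e ∧ ¬ L e}, Y e) → ∀ e, Y e :=
    fun K U e => if h : C e then K ⟨e, h⟩ else if h' : L e then w e else U ⟨e, h, h'⟩
  let φ : (∀ e : {e // C e}, Y e) × (∀ e : {e // ¬ C e ∧ ¬ L e}, Y e) ×
      (∀ e : {e // ¬ C e ∧ L e}, Y e) ≃ ∀ e, Y e :=
    { toFun := fun p e => if h : C e then p.1 ⟨e, h⟩ else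
        if h' : L e then p.2.2 ⟨e, h, h'⟩ else p.2.1 ⟨e, h, h'⟩
      invFun := fun W => (fun e => W e, fun e => W e, fun e => W e)
      left_inv := by
        rintro ⟨K, U, U'⟩
        refine Prod.ext (funext ?_) (Prod.ext (funext ?_) (funext ?_))
        · rintro ⟨e, he⟩; simp [he]
        · rintro ⟨e, he⟩; simp [he]
        · rintro ⟨e, he⟩; simp [he]
      right_inv := by
        intro W
        funext e
        dsimp only
        split_ifs <;> rfl }
  refine ⟨glueL, glueR, fun f g hf hg => ?_⟩
  rw [← φ.sum_comp, Fintype.sum_prod_type]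
  refine Finset.sum_congr rfl fun K _ => ?_
  rw [Fintype.sum_prod_type, Finset.sum_mul_sum]
  refine Finset.sum_congr rfl fun U _ => Finset.sum_congr rfl fun U' _ => ?_
  rw [mul_comm]
  congr 1
  · refine hg _ _ fun e he => ?_
    by_cases h : C e
    · simp [φ, glueR, h]
    · have h' := he.resolve_left h
      simp [φ, glueR, h, h']
  · refine hf _ _ fun e he => ?_
    by_cases h : C e
    · simp [φ, glueL, h]
    · have h' := he.resolve_left h
      simp [φ, glueL, h, h']

namespace OpenGraph

variable {V S T E : Type*}

theorem attach_openEnd (G : OpenGraph V S T E) (u : S ⊕ T) :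
    G.attach (G.openEnd u) = Sum.inr u :=
  (G.attach_eq_inr_iff _ _).2 rfl

theorem attach_localOrder (G : OpenGraph V S T E) (v : V) (i : Fin (G.deg v)) :
    G.attach (G.edgeAt v i, (G.localOrder v i).1.2) = Sum.inl v :=
  (G.localOrder v i).2

theorem exists_edgeAt_eq (G : OpenGraph V S T E) {v : V} {e : E} {b : Bool}
    (h : G.attach (e, b) = Sum.inl v) : ∃ i, G.edgeAt v i = e :=
  ⟨(G.localOrder v).symm ⟨(e, b), h⟩, by simp [edgeAt]⟩

/-- The rank of a contraction is at most the capacity of every edge cut. -/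
theorem rank_contraction_le_of_isEdgeCut [Fintype V] [Fintype S] [Fintype T] [Fintype E]
    [DecidableEq S] [DecidableEq E] (G : OpenGraph V S T E) {c : E → ℕ} (hc : ∀ e, 0 < c e)
    (τ : G.TensorAssignment c) {C : Finset E} (hC : G.IsEdgeCut C) :
    (G.contraction c τ).rank ≤ ∏ e ∈ C, c e := by
  classical
  obtain ⟨A, hS, hT, hA⟩ := hC
  -- Both ends of an edge outside `C` lie on the same side, so either end could define `L`.
  let L : E → Prop := fun e => G.attach (e, false) ∈ A
  have side_mem : ∀ e b, G.attach (e, b) ∈ A → e ∈ C ∨ L e := by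
    intro e b h
    by_contra! hn
    cases b
    · exact hn.2 h
    · exact hn.1 ((hA e).2 ⟨true, h, hn.2⟩)
  have side_not_mem : ∀ e b, G.attach (e, b) ∉ A → e ∈ C ∨ ¬ L e := by
    intro e b h
    by_contra! hn
    cases b
    · exact h hn.2
    · exact hn.1 ((hA e).2 ⟨false, hn.2, h⟩)
  have side_in : ∀ u : S, G.inputEdge u ∈ C ∨ L (G.inputEdge u) := fun u =>
    side_mem _ (G.openEnd (Sum.inl u)).2 (by
      have := G.attach_openEnd (Sum.inl u); rw [inputEdge, Prod.mk.eta, this]; exact hS u)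
  have side_out : ∀ u : T, G.outputEdge u ∈ C ∨ ¬ L (G.outputEdge u) := fun u =>
    side_not_mem _ (G.openEnd (Sum.inr u)).2 (by
      have := G.attach_openEnd (Sum.inr u); rw [outputEdge, Prod.mk.eta, this]; exact hT u)
  let f : G.InputIndex c → (∀ e, Fin (c e)) → ℂ := fun I W =>
    if ∀ u : S, W (G.inputEdge u) = I u then
      ∏ v : V with Sum.inl v ∈ A, τ v (fun i => W (G.edgeAt v i)) else 0
  let g : G.OutputIndex c → (∀ e, Fin (c e)) → ℂ := fun J W =>
    if ∀ u : T, W (G.outputEdge u) = J u then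
      ∏ v : V with Sum.inl v ∉ A, τ v (fun i => W (G.edgeAt v i)) else 0
  have hf : ∀ I, ∀ W W' : ∀ e, Fin (c e), (∀ e, e ∈ C ∨ L e → W e = W' e) → f I W = f I W' := by
    intro I W W' h
    have h1 : ∀ u : S, W (G.inputEdge u) = W' (G.inputEdge u) := fun u => h _ (side_in u)
    simp only [f, h1]
    congr 1
    refine Finset.prod_congr rfl fun v hv => ?_
    congr 1
    funext i
    refine h _ (side_mem _ (G.localOrder v i).1.2 ?_)
    rw [attach_localOrder]
    simpa using hv
  have hg : ∀ J, ∀ W W' : ∀ e, Fin (c e), (∀ e, e ∈ C ∨ ¬ L e → W e = W' e) →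
      g J W = g J W' := by
    intro J W W' h
    have h1 : ∀ u : T, W (G.outputEdge u) = W' (G.outputEdge u) := fun u => h _ (side_out u)
    simp only [g, h1]
    congr 1
    refine Finset.prod_congr rfl fun v hv => ?_
    congr 1
    funext i
    refine h _ (side_not_mem _ (G.localOrder v i).1.2 ?_)
    rw [attach_localOrder]
    simpa using hv
  obtain ⟨glueL, glueR, hglue⟩ := sum_pi_mul_eq_sum_pi_subtype (R := ℂ) (Y := fun e => Fin (c e))
    (fun e => e ∈ C) L (fun e => ⟨0, hc e⟩)
  have hfac : G.contraction c τ =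
      (Matrix.of fun J K => ∑ W, g J (glueR K W)) * Matrix.of fun K I => ∑ W, f I (glueL K W) := by
    ext J I
    simp only [Matrix.mul_apply, Matrix.of_apply]
    refine Eq.trans ?_ ((hglue (f I) (g J) (hf I) (hg J)).trans (by congr!))
    rw [contraction, Finset.sum_filter]
    refine Finset.sum_congr rfl fun W _ => ?_
    simp only [f, g, ite_mul, mul_ite, zero_mul, mul_zero]
    rw [Finset.prod_filter_mul_prod_filter_not]
    split_ifs with h
    all_goals first | rfl | exact absurd h.1 ‹_› | exact absurd h.2 ‹_› | exact absurd ⟨‹_›, ‹_›⟩ h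
  rw [hfac]
  refine ((Matrix.rank_mul_le_left _ _).trans (Matrix.rank_le_card_width _)).trans ?_
  rw [Fintype.card_pi]
  simp only [Fintype.card_fin]
  exact (Finset.prod_coe_sort C c).le

/-! ### Lower bound: routing digits along disjoint walks -/

/-- Replace every edge `e` by `k e` parallel copies. If every edge cut contains at least `n` copies,
then there are `n` pairwise disjoint sets of copies, each of which contains a walk from the inputs
to the outputs. -/
theorem exists_disjoint_walks [Fintype E] (G : OpenGraph V S T E) (k : E → ℕ) (n : ℕ)
    (hn : ∀ C : Finset E, G.IsEdgeCut C → n ≤ ∑ e ∈ C, k e) :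
    ∃ P : Fin n → (Σ e, Fin (k e)) → Prop, (∀ i j x, P i x → P j x → i = j) ∧
      ∀ i, ∃ a b : Σ e, Fin (k e), (∃ u, G.inputEdge u = a.1) ∧ (∃ u, G.outputEdge u = b.1) ∧
        P i a ∧ Relation.ReflTransGen (fun x y => (x = y ∨ ∃ v b b',
          G.attach (x.1, b) = Sum.inl v ∧ G.attach (y.1, b') = Sum.inl v) ∧ P i x ∧ P i y) a b := by
  classical
  obtain ⟨P, hP, h⟩ := exists_disjoint_linking (X := Σ e, Fin (k e))
    (fun x y => ∃ v b b', G.attach (x.1, b) = Sum.inl v ∧ G.attach (y.1, b') = Sum.inl v)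
    {x | ∃ u, G.inputEdge u = x.1} {x | ∃ u, G.outputEdge u = x.1} n (by
      intro Z hZ
      -- The cut around the inputs and the vertices touched by `Z`. As `Z` avoids output edges, its
      -- copies lie inside `A`, hence off the cut; every cut copy is an input copy or a neighbour of
      -- `Z`.
      let A : Set (V ⊕ (S ⊕ T)) := {p | (∃ u, p = Sum.inr (Sum.inl u)) ∨
        ∃ v, p = Sum.inl v ∧ ∃ z ∈ Z, ∃ b, G.attach (z.1, b) = Sum.inl v}
      have hZA : ∀ z ∈ Z, ∀ b, G.attach (z.1, b) ∈ A := by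
        intro z hz b
        rcases hp : G.attach (z.1, b) with v | u | u
        · exact Or.inr ⟨v, rfl, z, hz, b, hp⟩
        · exact Or.inl ⟨u, rfl⟩
        · refine absurd ?_ (Set.disjoint_left.1 hZ hz)
          exact ⟨u, by rw [outputEdge, ← (G.attach_eq_inr_iff _ _).1 hp]⟩
      let C : Finset E := Finset.univ.filter
        fun e => ∃ b : Bool, G.attach (e, b) ∈ A ∧ G.attach (e, !b) ∉ A
      have hC : G.IsEdgeCut C := by
        refine ⟨A, fun u => Or.inl ⟨u, rfl⟩, ?_, fun e => by simp [C]⟩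
        rintro u (⟨w, hw⟩ | ⟨v, hv, -⟩)
        · simp at hw
        · simp at hv
      have hcard : ((C.sigma fun e => (Finset.univ : Finset (Fin (k e)))) :
          Set (Σ e, Fin (k e))).ncard = ∑ e ∈ C, k e := by
        rw [Set.ncard_coe_finset, Finset.card_sigma]
        simp
      have hmem : ∀ x ∈ ((C.sigma fun e => (Finset.univ : Finset (Fin (k e)))) :
          Set (Σ e, Fin (k e))), ∃ b : Bool, G.attach (x.1, b) ∈ A ∧ G.attach (x.1, !b) ∉ A := by
        intro x hx
        simpa [C] using hx
      calc n + Z.ncard ≤ (∑ e ∈ C, k e) + Z.ncard := by gcongr; exact hn C hC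
        _ = _ := by
          rw [← hcard, ← Set.ncard_union_eq]
          rw [Set.disjoint_left]
          intro x hx hxZ
          obtain ⟨b, -, hb⟩ := hmem x hx
          exact hb (hZA x hxZ _)
        _ ≤ _ := by
          refine Set.ncard_le_ncard ?_ (Set.toFinite _)
          rintro x (hx | hx)
          · obtain ⟨b, ⟨u, hu⟩ | ⟨v, hv, z, hz, b', hb'⟩, -⟩ := hmem x hx
            · exact Or.inl ⟨u, by rw [inputEdge, ← (G.attach_eq_inr_iff _ _).1 hu]⟩
            · exact Or.inr ⟨z, hz, Or.inr ⟨v, b', b, hb', hv⟩⟩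
          · exact Or.inr ⟨x, hx, Or.inl rfl⟩)
  refine ⟨P, hP, fun i => ?_⟩
  obtain ⟨a, ha, b, hb, h⟩ := h i
  exact ⟨a, b, ha, hb, h⟩

/-- If all capacities are powers of `d`, with exponents `k`, and every edge cut has total exponent
at least `n`, then some contraction has rank at least `d ^ n`. -/
theorem exists_pow_le_rank_contraction [Fintype V] [Fintype S] [Fintype T] [Fintype E]
    [DecidableEq S] [DecidableEq E] (G : OpenGraph V S T E) {d : ℕ} (hd : 0 < d) (k : E → ℕ)
    (n : ℕ) (hn : ∀ C : Finset E, G.IsEdgeCut C → n ≤ ∑ e ∈ C, k e) :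
    ∃ τ : G.TensorAssignment (fun e => d ^ k e),
      d ^ n ≤ (G.contraction (fun e => d ^ k e) τ).rank := by
  classical
  obtain ⟨P, hP, hwalk⟩ := G.exists_disjoint_walks k n hn
  let digit : ∀ e, Fin (d ^ k e) → Fin (k e) → Fin d := fun e => finFunctionFinEquiv.symm
  -- Only digits in a common set `P p` are constrained; digits outside all the sets are summed
  -- freely.
  let compat : ∀ v : V, (∀ i : Fin (G.deg v), Fin (d ^ k (G.edgeAt v i))) → Prop := fun v w =>
    ∀ p i j s t, P p ⟨G.edgeAt v i, s⟩ → P p ⟨G.edgeAt v j, t⟩ →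
      digit _ (w i) s = digit _ (w j) t
  let τ : G.TensorAssignment (fun e => d ^ k e) := fun v w => if compat v w then 1 else 0
  have hprod : ∀ W : ∀ e, Fin (d ^ k e), ∏ v, τ v (fun i => W (G.edgeAt v i)) =
      if ∀ v, compat v (fun i => W (G.edgeAt v i)) then 1 else 0 := by
    intro W
    simp only [τ]
    rw [Finset.prod_ite_zero]
    simp
  -- Entries are counts, so in characteristic zero one compatible `W` makes an entry nonzero.
  have hentry : ∀ I J, G.contraction (fun e => d ^ k e) τ J I =
      ((Finset.univ.filter fun W : ∀ e, Fin (d ^ k e) =>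
        G.Extends (fun e => d ^ k e) W I J ∧
          ∀ v, compat v (fun i => W (G.edgeAt v i))).card : ℂ) := by
    intro I J
    rw [contraction, Finset.sum_congr rfl fun W _ => hprod W, Finset.sum_boole,
      Finset.filter_filter]
  -- Digits outside all the sets get the arbitrary value `0`.
  let val : (Fin n → Fin d) → (Σ e, Fin (k e)) → Fin d := fun x s =>
    if h : ∃ p, P p s then x h.choose else ⟨0, hd⟩
  have hval : ∀ x p s, P p s → val x s = x p := by
    intro x p s hs
    have h : ∃ p, P p s := ⟨p, hs⟩
    simp only [val, dif_pos h]
    rw [hP _ _ _ h.choose_spec hs]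
  let index : (Fin n → Fin d) → ∀ e, Fin (d ^ k e) := fun x e =>
    finFunctionFinEquiv fun s => val x ⟨e, s⟩
  have hdigit : ∀ x e s, digit e (index x e) s = val x ⟨e, s⟩ := by
    intro x e s
    simp only [digit, index, Equiv.symm_apply_apply]
  have hconst : ∀ W : ∀ e, Fin (d ^ k e), (∀ v, compat v (fun i => W (G.edgeAt v i))) →
      ∀ p a b, Relation.ReflTransGen (fun x y => (x = y ∨ ∃ v b b',
        G.attach (x.1, b) = Sum.inl v ∧ G.attach (y.1, b') = Sum.inl v) ∧ P p x ∧ P p y) a b →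
      digit a.1 (W a.1) a.2 = digit b.1 (W b.1) b.2 := by
    intro W hW p a b h
    induction h with
    | refl => rfl
    | @tail y z _ hyz ih =>
      rw [ih]
      obtain ⟨rfl | ⟨v, b, b', hb, hb'⟩, hy, hz⟩ := hyz
      · rfl
      · obtain ⟨e, s⟩ := y
        obtain ⟨e', t⟩ := z
        obtain ⟨i, rfl⟩ := G.exists_edgeAt_eq hb
        obtain ⟨j, rfl⟩ := G.exists_edgeAt_eq hb'
        exact hW v p i j s t hy hz
  refine ⟨τ, ?_⟩
  let w : (Fin n → Fin d) → ℂ := fun x => G.contraction (fun e => d ^ k e) τ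
    (fun u => index x (G.outputEdge u)) (fun u => index x (G.inputEdge u))
  have hsub : (G.contraction (fun e => d ^ k e) τ).submatrix
      (fun x u => index x (G.outputEdge u)) (fun x u => index x (G.inputEdge u)) =
      Matrix.diagonal w := by
    ext x y
    rw [Matrix.submatrix_apply, Matrix.diagonal_apply]
    split_ifs with hxy
    · rw [hxy]
    · rw [hentry, Nat.cast_eq_zero, Finset.card_eq_zero, Finset.filter_eq_empty_iff]
      -- A contributing `W` carries the input digit `y p` unchanged to the output digit `x p`, for
      -- every `p`.
      rintro W - ⟨⟨hI, hJ⟩, hW⟩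
      apply hxy
      funext p
      obtain ⟨⟨e, s⟩, ⟨e', t⟩, ⟨u, hu⟩, ⟨u', hu'⟩, ha, h⟩ := hwalk p
      have hb : P p ⟨e', t⟩ := by
        rcases Relation.ReflTransGen.cases_tail h with h' | ⟨_, -, h'⟩
        · rw [h']; exact ha
        · exact h'.2.2
      have := hconst W hW p _ _ h
      subst hu hu'
      simp only at this
      rw [hI u, hJ u', hdigit, hdigit, hval y p _ ha, hval x p _ hb] at this
      exact this.symm
  have hw : ∀ x, w x ≠ 0 := by
    intro x
    simp only [w]
    rw [hentry, Nat.cast_ne_zero, Finset.card_ne_zero]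
    refine ⟨index x, ?_⟩
    rw [Finset.mem_filter_univ]
    refine ⟨⟨fun u => rfl, fun u => rfl⟩, ?_⟩
    intro v p i j s t hs ht
    rw [hdigit, hdigit, hval x p _ hs, hval x p _ ht]
  calc d ^ n = (Matrix.diagonal w).rank := by
        rw [Matrix.rank_diagonal]
        simp [hw]
    _ ≤ _ := by
        rw [← hsub]
        exact Matrix.rank_submatrix_le _ _ _

end OpenGraph

theorem theorem3p6 {V S T E : Type*} [Fintype V] [Fintype S] [Fintype T] [Fintype E]
    [DecidableEq S] [DecidableEq E]
    (G : OpenGraph V S T E) (c : E → ℕ)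
    (hc : ∃ d : ℕ, 0 < d ∧ ∀ e : E, ∃ k : ℕ, c e = d ^ k) :
    G.quantumMaxFlow c = G.quantumMinCut c := by
  obtain ⟨d, hd, hc⟩ := hc
  choose k hk using hc
  obtain rfl : c = fun e => d ^ k e := funext hk
  apply le_antisymm
  · obtain ⟨τ, hτ⟩ := (G.quantumMaxFlow_isGreatest fun e => d ^ k e).1
    obtain ⟨C, hC, hq⟩ := (G.quantumMinCut_isLeast fun e => d ^ k e).1
    rw [hτ, hq]
    exact G.rank_contraction_le_of_isEdgeCut (fun e => Nat.pow_pos hd) τ hC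
  · obtain ⟨C₀, hC₀, -⟩ := (G.quantumMinCut_isLeast fun e => d ^ k e).1
    -- The exponent sum is minimized instead of the product, which does not determine it when `d =
    -- 1`.
    obtain ⟨C, hC, hmin⟩ := exists_minimalFor_of_wellFoundedLT G.IsEdgeCut
      (fun C => ∑ e ∈ C, k e) ⟨C₀, hC₀⟩
    obtain ⟨τ, hτ⟩ := G.exists_pow_le_rank_contraction hd k (∑ e ∈ C, k e)
      fun C' hC' => (le_total _ _).elim id (hmin hC')
    calc _ ≤ ∏ e ∈ C, d ^ k e := (G.quantumMinCut_isLeast fun e => d ^ k e).2 ⟨C, hC, rfl⟩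
      _ = d ^ ∑ e ∈ C, k e := Finset.prod_pow_eq_pow_sum _ _ _
      _ ≤ _ := hτ
      _ ≤ _ := (G.quantumMaxFlow_isGreatest fun e => d ^ k e).2 ⟨τ, rfl⟩
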